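/- Let $d\in\{2,3\}$, let $\mathcal G=(\mathcal V,\mathcal E)$ be a finite simple undirected graph with $\mathcal V=\{1,\dots,n\}$ and $m=|\mathcal E|$, let $\mathcal A\subseteq\mathcal V^3$ with $w=|\mathcal A|$, and let $\chi\subseteq\mathbb R^{dn}$ be the set of all configurations $q=(q_1,\dots,q_n)$, $q_i\in\mathbb R^d$, with $q_k\neq q_i$ and $q_k\neq q_j$ for all $(k,i,j)\in\mathcal A$. For $q\in\chi$ and $(k,i,j)\in\mathcal A$ let $\theta^k_{ij}(q)\in[0,\pi]$ be the angle at $q_k$ between $q_i-q_k$ and $q_j-q_k$. The weak rigidity function is $$F_W:\chi\to\mathbb R^{m+w},\qquad F_W(q)=\Big(\big(\|q_i-q_j\|^2\big)_{\{i,j\}\in\mathcal E},\ \big(\cos\theta^k_{ij}(q)\big)_{(k,i,j)\in\mathcal A}\Big),$$ and $R_W(q)=\partial F_W(q)/\partial q\in\mathbb R^{(m+w)\times dn}$ is its Jacobian matrix. A point $p\in\chi$ is a regular point of $F_W$ if $\operatorname{rank}R_W(p)=\max_{q\in\chi}\operatorname{rank}R_W(q)$. Configurations $q$ and $p$ are congruent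 if $\|q_i-q_j\|=\|p_i-p_j\|$ for all $i,j\in\mathcal V$, and proportionally congruent if for some $C>0$ one has $\|q_i-q_j\|=C\|p_i-p_j\|$ for all $i,j\in\mathcal V$. For $p\in\chi$, the framework $(\mathcal G,\mathcal A,p)$ is generalized weakly rigid (GWR) in $\mathbb R^d$ if there is a neighbourhood $B$ of $p$ such that every $q\in B\cap\chi$ with $\|q_i-q_j\|=\|p_i-p_j\|$ for all $\{i,j\}\in\mathcal E$ and $\cos\theta^k_{ij}(q)=\cos\theta^k_{ij}(p)$ for all $(k,i,j)\in\mathcal A$ is congruent to $p$. If $\mathcal E=\emptyset$, the framework is also called GWR if there is a neighbourhood $B$ of $p$ such that every $q\in B\cap\chi$ with $\cos\theta^k_{ij}(q)=\cos\theta^k_{ij}(p)$ for all $(k,i,j)\in\mathcal A$ is proportionally congruent to $p$. Suppose that $p$ is a regular point of $F_W$ and that the affine span of $p_1,\dots,p_n$ is $\mathbb R^d$. 1. If $\mathcal E\neq\emptyset$, then $(\mathcal G,\mathcal A,p)$ is GWR in $\mathbb R^d$ if and only if $\operatorname{rank}R_W(p)=dn-d(d+1)/2$. 2. If $\mathcal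 E=\emptyset$, then $(\mathcal G,\mathcal A,p)$ is GWR in $\mathbb R^d$ if and only if $\operatorname{rank}R_W(p)=dn-(d^2+d+2)/2$. -/

import Mathlib

open scoped Topology

noncomputable section

namespace WeakRigidity

/-- A configuration `p = (p₁, …, pₙ)` of `n` points of Euclidean space `ℝᵈ`, that is, a point of
`ℝᵈⁿ`. -/
abbrev Config (n d : ℕ) : Type := Fin n → EuclideanSpace ℝ (Fin d)

variable {n d : ℕ}

/-- The cosine of the angle `θᵏᵢⱼ` at `pₖ` between `pᵢ` and `pⱼ`, for a triple `t = (k, i, j)`. -/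
def cosAngle (t : Fin n × Fin n × Fin n) (p : Config n d) : ℝ :=
  Real.cos (EuclideanGeometry.angle (p t.2.1) (p t.1) (p t.2.2))

/-- The squared length `‖pᵢ - pⱼ‖²` of the unordered pair `e = {i, j}`. -/
def sqLength (e : Sym2 (Fin n)) (p : Config n d) : ℝ :=
  Sym2.lift ⟨fun i j => ‖p i - p j‖ ^ 2, fun i j => by simp only [norm_sub_rev]⟩ e

/-- The domain `χ` of the weak rigidity function: the configurations for which no denominator
`‖pₖ - pᵢ‖ ‖pₖ - pⱼ‖`, `(k, i, j) ∈ A`, vanishes. -/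
def domain (A : Finset (Fin n × Fin n × Fin n)) : Set (Config n d) :=
  {p | ∀ t ∈ A, p t.1 ≠ p t.2.1 ∧ p t.1 ≠ p t.2.2}

/-- The weak rigidity function `F_W`, with one coordinate for each edge (the squared length) and one
for each element of `A` (the cosine of the angle). -/
def weakRigidityFunction (G : SimpleGraph (Fin n)) (A : Finset (Fin n × Fin n × Fin n))
    (p : Config n d) : G.edgeSet ⊕ A → ℝ :=
  Sum.elim (fun e => sqLength e.1 p) (fun t => cosAngle t.1 p)

/-- The weak rigidity matrix `R_W(p)`: the Jacobian matrix of `F_W` at `p`. The column `(i, l)`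
holds the partial derivatives with respect to the `l`-th coordinate of `pᵢ`. -/
def weakRigidityMatrix (G : SimpleGraph (Fin n)) (A : Finset (Fin n × Fin n × Fin n))
    (p : Config n d) : Matrix (G.edgeSet ⊕ A) (Fin n × Fin d) ℝ :=
  Matrix.of fun a c =>
    fderiv ℝ (fun q : Config n d => weakRigidityFunction G A q a) p
      (Pi.single c.1 (EuclideanSpace.single c.2 1))

/-- `p` is a regular point of `F_W : χ → ℝᵐ⁺ʷ`: it lies in `χ` and the rank of the Jacobian of
`F_W` attains at `p` its maximum over `χ`. -/
def IsRegularPoint (G : SimpleGraph (Fin n)) (A : Finset (Fin n × Fin n × Fin n))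
    (p : Config n d) : Prop :=
  p ∈ domain A ∧ IsMaxOn (fun q : Config n d => (weakRigidityMatrix G A q).rank) (domain A) p

/-- Congruent configurations. -/
def Congruent (p q : Config n d) : Prop :=
  ∀ i j, ‖p i - p j‖ = ‖q i - q j‖

/-- Proportionally congruent configurations. -/
def ProportionallyCongruent (p q : Config n d) : Prop :=
  ∃ C : ℝ, 0 < C ∧ ∀ i j, ‖p i - p j‖ = C * ‖q i - q j‖

/-- Angle equivalent frameworks. -/
def AngleEquivalent (A : Finset (Fin n × Fin n × Fin n)) (p q : Config n d) : Prop :=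
  ∀ t ∈ A, cosAngle t p = cosAngle t q

/-- Strongly equivalent frameworks. -/
def StronglyEquivalent (G : SimpleGraph (Fin n)) (A : Finset (Fin n × Fin n × Fin n))
    (p q : Config n d) : Prop :=
  (∀ i j, G.Adj i j → ‖p i - p j‖ = ‖q i - q j‖) ∧ ∀ t ∈ A, cosAngle t p = cosAngle t q

/-- Generalized weak rigidity of the framework `(G, A, p)`: all strongly equivalent configurations
`q` near `p` are congruent to `p`, or there are no edges and all angle equivalent configurations `q`
near `p` are proportionally congruent to `p`. The condition `q ∈ domain A` says that all angles of
`(G, A, q)` that belong to `A` are defined. -/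
def IsGWR (G : SimpleGraph (Fin n)) (A : Finset (Fin n × Fin n × Fin n)) (p : Config n d) : Prop :=
  (∃ B ∈ 𝓝 p, ∀ q ∈ B, q ∈ domain A → StronglyEquivalent G A q p → Congruent q p) ∨
  (G.edgeSet = ∅ ∧
    ∃ B ∈ 𝓝 p, ∀ q ∈ B, q ∈ domain A → AngleEquivalent A q p → ProportionallyCongruent q p)

end WeakRigidity

end

/-! Rigidity is a local inclusion of fibres: the fibre of `F_W` through `p` must lie, near `p`, in
the fibre of a reference map `g`. With edges, `g = sqDist`, whose fibres are congruence classes;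
without edges, `g = shape`, the squared distances divided by their sum, whose fibres are
proportional congruence classes. By the law of cosines `F_W` factors through `sqDist`; angles being
scale invariant, it factors through `shape` when there are no edges. Hence `ker Dg ≤ ker DF_W` near
`p`. At a regular point `F_W` has locally constant rank, so its fibre is parametrized by `ker
DF_W(p)`, and differentiating `g` along it shows that the inclusion of fibres is equivalent to
equality of the ranks of `DF_W(p)` and `Dg(p)` (`eventually_fiber_subset_iff`). The rank of `Dg(p)`
comes from its kernel. For an affinely spanning configuration the infinitesimal motions are the
fields `x ↦ S x + t` with `S` skew (`range_trivialMotion`), of dimension `d(d-1)/2 + d`; for `shape`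
the dilation adds one dimension (`ker_fderiv_shape`). -/

noncomputable section

namespace WeakRigidity

/-! ### Constant rank and inclusion of fibres -/

section ConstantRank

variable {E F G : Type*} [NormedAddCommGroup E] [NormedSpace ℝ E]
  [NormedAddCommGroup F] [NormedSpace ℝ F] [FiniteDimensional ℝ F]
  [NormedAddCommGroup G] [NormedSpace ℝ G]

/-- Every linear map between finite-dimensional spaces has a generalized inverse. -/
theorem exists_generalizedInverse (L : E →L[ℝ] F) : ∃ T : F →L[ℝ] E, ∀ x, L (T (L x)) = L x := by
  obtain ⟨σ, hσ⟩ := (L : E →ₗ[ℝ] F).rangeRestrict.exists_rightInverse_of_surjective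
    (LinearMap.range_rangeRestrict _)
  obtain ⟨T, hT⟩ := σ.exists_extend
  refine ⟨LinearMap.toContinuousLinearMap T, fun x => ?_⟩
  have h1 : T (L x) = σ ((L : E →ₗ[ℝ] F).rangeRestrict x) :=
    LinearMap.congr_fun hT ((L : E →ₗ[ℝ] F).rangeRestrict x)
  have h2 := congrArg Subtype.val (LinearMap.congr_fun hσ ((L : E →ₗ[ℝ] F).rangeRestrict x))
  simpa [h1] using h2

/-- Rank at least `r` is an open condition on operators. Combined with the upper bound at a regular
point, this makes the rank constant nearby. -/
theorem eventually_finrank_range_le {X : Type*} [TopologicalSpace X] {A : X → E →L[ℝ] F} {p : X}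
    (hA : ContinuousAt A p) :
    ∀ᶠ q in 𝓝 p, Module.finrank ℝ (A p).range ≤ Module.finrank ℝ (A q).range := by
  have h := (isOpen_setOfPred_nat_le_rank (𝕜 := ℝ) (E := E) (F := F)
    (Module.finrank ℝ (A p).range)).mem_nhds (x := A p) (by
      simp [LinearMap.rank, Module.finrank_eq_rank])
  filter_upwards [hA h] with q hq
  have hle : (Module.finrank ℝ (A p).range : Cardinal) ≤ (A q : E →ₗ[ℝ] F).rank := hq
  rw [LinearMap.rank, ← Module.finrank_eq_rank] at hle
  exact_mod_cast hle

/-- Constant rank theorem for a fibre: if the rank of `Df` does not increase near `p`, then the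
fibre of `f` through `p` is parametrized, near `p`, by the kernel of `Df(p)`. -/
theorem exists_fiber_parametrization [FiniteDimensional ℝ E] {f : E → F} {p : E} (hf : ContDiffAt ℝ 1 f p)
    (hrank : ∀ᶠ q in 𝓝 p,
      Module.finrank ℝ (fderiv ℝ f q).range ≤ Module.finrank ℝ (fderiv ℝ f p).range) :
    ∃ (κ : (fderiv ℝ f p).ker → E) (ρ : E → (fderiv ℝ f p).ker),
      κ 0 = p ∧ ContDiffAt ℝ 1 κ 0 ∧ HasFDerivAt κ (fderiv ℝ f p).ker.subtypeL 0 ∧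
      ρ p = 0 ∧ ContinuousAt ρ p ∧ (∀ᶠ y in 𝓝 0, f (κ y) = f p) ∧
      ∀ᶠ q in 𝓝 p, f q = f p → κ (ρ q) = q := by
  set L := fderiv ℝ f p with hL
  obtain ⟨T, hT⟩ := exists_generalizedInverse L
  -- Since `L T L = L`, the derivative of `Φ` at `p` is `T L + (1 - T L) = id`, so `Φ` is a local
  -- diffeomorphism. It also satisfies `L (Φ q) = P (f q - f p)` for the `P = L T` below.
  let Φ : E → E := fun q => T (f q) - T (f p) + ((q - p) - T (L (q - p)))
  have hfp : HasFDerivAt f L p := (hf.differentiableAt one_ne_zero).hasFDerivAt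
  have hΦ : ContDiffAt ℝ 1 Φ p := by
    have h1 : ContDiffAt ℝ 1 (fun q => T (f q)) p := T.contDiff.contDiffAt.comp p hf
    have h2 : ContDiffAt ℝ 1 (fun q => T (L (q - p))) p := by fun_prop
    fun_prop
  have hΦ' : HasFDerivAt Φ ((ContinuousLinearEquiv.refl ℝ E : E ≃L[ℝ] E) : E →L[ℝ] E) p := by
    have h1 : HasFDerivAt (fun q => T (f q)) (T.comp L) p := T.hasFDerivAt.comp p hfp
    have h2 : HasFDerivAt (fun q : E => q - p) (ContinuousLinearMap.id ℝ E) p :=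
      (hasFDerivAt_id p).sub_const p
    have h3 : HasFDerivAt (fun q => T (L (q - p))) (T.comp L) p :=
      (T.comp L).hasFDerivAt.comp p h2
    refine ((h1.sub_const _).add (h2.sub h3)).congr_fderiv ?_
    ext x
    simp
  have hΦp : Φ p = 0 := by simp [Φ]
  have hs := hΦ.hasStrictFDerivAt' hΦ' one_ne_zero
  let ψ : E → E := hΦ.localInverse hΦ' one_ne_zero
  have hψ0 : ψ 0 = p := by rw [← hΦp]; exact hΦ.localInverse_apply_image hΦ' one_ne_zero
  have hψc : ContDiffAt ℝ 1 ψ 0 := by rw [← hΦp]; exact hΦ.to_localInverse hΦ' one_ne_zero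
  have hψd : HasFDerivAt ψ (ContinuousLinearMap.id ℝ E) 0 := by
    rw [← hΦp]; exact hs.to_localInverse.hasFDerivAt
  have hr : ∀ᶠ y in 𝓝 (0 : E), Φ (ψ y) = y := by
    rw [← hΦp]; exact hs.eventually_right_inverse
  have hl : ∀ᶠ q in 𝓝 p, ψ (Φ q) = q := hs.eventually_left_inverse
  let π : E →L[ℝ] L.ker := (ContinuousLinearMap.id ℝ E - T.comp L).codRestrict L.ker
    (fun x => by simp [hT])
  let κ : L.ker → E := fun y => ψ y
  have hκ0 : κ 0 = p := hψ0
  have hκd : HasFDerivAt κ L.ker.subtypeL 0 := by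
    have : HasFDerivAt ψ (ContinuousLinearMap.id ℝ E) ((0 : L.ker) : E) := hψd
    exact (this.comp (0 : L.ker) L.ker.subtypeL.hasFDerivAt).congr_fderiv (by ext; simp)
  have hκc : ContDiffAt ℝ 1 κ 0 :=
    ContDiffAt.comp (g := ψ) (f := fun y : L.ker => (y : E)) (0 : L.ker) (by exact hψc)
      L.ker.subtypeL.contDiff.contDiffAt
  have hκt : Filter.Tendsto κ (𝓝 0) (𝓝 p) := by
    have := hκc.continuousAt.tendsto; rwa [hκ0] at this
  let P : F →L[ℝ] F := L.comp T
  have hPL : P.comp L = L := by ext x; simp [P, hT]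
  -- Rank squeeze: `P ∘ Df(q)` has rank at least that of `P ∘ L = L`, while `Df(q)` has rank at most
  -- that of `L`. So `P` is injective on the range of `Df(q)`.
  have hlow : ∀ᶠ q in 𝓝 p,
      Module.finrank ℝ L.range ≤ Module.finrank ℝ (P.comp (fderiv ℝ f q)).range := by
    have hc : ContinuousAt (fun q => P.comp (fderiv ℝ f q)) p :=
      continuousAt_const.clm_comp ((hf.fderiv_right (m := 0) (by norm_num)).continuousAt)
    have := eventually_finrank_range_le hc
    rwa [← hL, hPL] at this
  have hker : ∀ᶠ q in 𝓝 p, (P.comp (fderiv ℝ f q)).ker = (fderiv ℝ f q).ker := by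
    filter_upwards [hlow, hrank] with q h1 h2
    have hle : (fderiv ℝ f q).ker ≤ (P.comp (fderiv ℝ f q)).ker := by
      intro x hx
      have hx' : fderiv ℝ f q x = 0 := hx
      simp [hx']
    refine (Submodule.eq_of_le_of_finrank_le hle ?_).symm
    have e1 := LinearMap.finrank_range_add_finrank_ker (fderiv ℝ f q : E →ₗ[ℝ] F)
    have e2 := LinearMap.finrank_range_add_finrank_ker (P.comp (fderiv ℝ f q) : E →ₗ[ℝ] F)
    omega
  have hdf : ∀ᶠ q in 𝓝 p, DifferentiableAt ℝ f q := by
    filter_upwards [hf.eventually (by simp)] with q hq using hq.differentiableAt one_ne_zero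
  have hPf : ∀ᶠ y in 𝓝 (0 : L.ker), P (f (κ y)) = P (f p) := by
    have : Filter.Tendsto (fun y : L.ker => (y : E)) (𝓝 0) (𝓝 0) :=
      (L.ker.subtypeL.continuous.tendsto 0)
    filter_upwards [this hr] with y hy
    have h1 : L (Φ (ψ y)) = 0 := by
      have : Φ (ψ y) = y := hy
      rw [this]; exact y.2
    simp only [Φ, map_add, map_sub, hT] at h1
    simpa [sub_eq_zero, P, κ] using h1
  -- `P ∘ f ∘ κ` is locally constant, and `P` kills nothing in the range of `Df(κ y)`; hence `f ∘ κ`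
  -- itself has zero derivative.
  have hball : ∀ᶠ y in 𝓝 (0 : L.ker), DifferentiableAt ℝ (fun z => f (κ z)) y ∧
      fderiv ℝ (fun z => f (κ z)) y = 0 := by
    filter_upwards [hPf.eventually_nhds, hκc.eventually (by simp), hκt hdf, hκt hker]
      with y h1 h2 h3 h4
    have h3' : DifferentiableAt ℝ f (κ y) := h3
    have hky : HasFDerivAt κ (fderiv ℝ κ y) y := (h2.differentiableAt one_ne_zero).hasFDerivAt
    have hfy : HasFDerivAt (fun z => f (κ z)) ((fderiv ℝ f (κ y)).comp (fderiv ℝ κ y)) y :=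
      h3'.hasFDerivAt.comp y hky
    refine ⟨hfy.differentiableAt, ?_⟩
    rw [hfy.fderiv]
    have hPy : HasFDerivAt (fun z => P (f (κ z)))
        (P.comp ((fderiv ℝ f (κ y)).comp (fderiv ℝ κ y))) y := P.hasFDerivAt.comp y hfy
    have hz := hPy.unique ((hasFDerivAt_const (P (f p)) y).congr_of_eventuallyEq h1)
    ext w
    have hw : fderiv ℝ κ y w ∈ (P.comp (fderiv ℝ f (κ y))).ker := by
      simpa using DFunLike.congr_fun hz w
    have h4' : (P.comp (fderiv ℝ f (κ y))).ker = (fderiv ℝ f (κ y)).ker := h4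
    rw [h4'] at hw
    simpa using hw
  refine ⟨κ, fun q => π (q - p), hκ0, hκc, hκd, by simp, by fun_prop, ?_, ?_⟩
  · obtain ⟨ε, hε, hb⟩ := Metric.eventually_nhds_iff_ball.1 hball
    filter_upwards [Metric.ball_mem_nhds 0 hε] with y hy
    have := Metric.isOpen_ball.is_const_of_fderiv_eq_zero (f := fun z => f (κ z))
      (convex_ball (0 : L.ker) ε).isPreconnected
      (fun z hz => (hb z hz).1.differentiableWithinAt) (fun z hz => (hb z hz).2) hy
      (Metric.mem_ball_self hε)
    simpa [hκ0] using this
  · filter_upwards [hl] with q hq hfq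
    -- On the fibre the terms in `f` cancel, leaving the projection `1 - T L`, with values in `ker
    -- L`.
    have : Φ q = (π (q - p) : E) := by simp [Φ, π, hfq]; abel
    change ψ (π (q - p) : E) = q
    rw [← this, hq]

/-- If `Df` has locally maximal rank at `p` and the kernel of `Dg` is contained in that of `Df`,
then the fibre of `f` through `p` is locally contained in that of `g` if and only if `Df` and `Dg`
have the same rank at `p`. -/
theorem eventually_fiber_subset_iff [FiniteDimensional ℝ E] [FiniteDimensional ℝ G] {f : E → F} {g : E → G} {p : E} (hf : ContDiffAt ℝ 1 f p)
    (hg : ContDiffAt ℝ 1 g p)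
    (hrank : ∀ᶠ q in 𝓝 p,
      Module.finrank ℝ (fderiv ℝ f q).range ≤ Module.finrank ℝ (fderiv ℝ f p).range)
    (hker : ∀ᶠ q in 𝓝 p, (fderiv ℝ g q).ker ≤ (fderiv ℝ f q).ker)
    (hdim : ∀ᶠ q in 𝓝 p,
      Module.finrank ℝ (fderiv ℝ g p).ker ≤ Module.finrank ℝ (fderiv ℝ g q).ker) :
    (∀ᶠ q in 𝓝 p, f q = f p → g q = g p) ↔
      Module.finrank ℝ (fderiv ℝ f p).range = Module.finrank ℝ (fderiv ℝ g p).range := by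
  obtain ⟨κ, ρ, hκ0, hκc, hκd, hρ0, hρc, hfκ, hκρ⟩ := exists_fiber_parametrization hf hrank
  have hκt : Filter.Tendsto κ (𝓝 0) (𝓝 p) := by
    have := hκc.continuousAt.tendsto; rwa [hκ0] at this
  have rn (q : E) := LinearMap.finrank_range_add_finrank_ker (fderiv ℝ f q : E →ₗ[ℝ] F)
  have rn' (q : E) := LinearMap.finrank_range_add_finrank_ker (fderiv ℝ g q : E →ₗ[ℝ] G)
  constructor
  · intro h
    -- As `κ` has the inclusion of `ker Df(p)` as derivative at `0`, constancy of `g ∘ κ` forces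
    -- `Dg(p)` to vanish on `ker Df(p)`.
    have hgκ : ∀ᶠ y in 𝓝 0, g (κ y) = g p := by
      filter_upwards [hκt h, hfκ] with y h1 h2 using h1 h2
    have h1 : HasFDerivAt (fun y => g (κ y)) ((fderiv ℝ g p).comp (fderiv ℝ f p).ker.subtypeL) 0 :=
      HasFDerivAt.comp 0 (by rw [hκ0]; exact (hg.differentiableAt one_ne_zero).hasFDerivAt) hκd
    have hz := h1.unique ((hasFDerivAt_const (g p) 0).congr_of_eventuallyEq hgκ)
    have hle : (fderiv ℝ f p).ker ≤ (fderiv ℝ g p).ker := fun v hv => by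
      simpa using DFunLike.congr_fun hz (⟨v, hv⟩ : (fderiv ℝ f p).ker)
    have heq := le_antisymm hle hker.self_of_nhds
    have e1 := rn p
    have e2 := rn' p
    rw [heq] at e1
    omega
  · intro h
    have hlow := eventually_finrank_range_le (A := fderiv ℝ f) (p := p)
      ((hf.fderiv_right (m := 0) (by norm_num)).continuousAt)
    -- Near `p`, `dim ker Dg(q) ≥ dim ker Dg(p) = dim ker Df(p) ≥ dim ker Df(q)`, so the inclusion
    -- of kernels is an equality.
    have heq : ∀ᶠ q in 𝓝 p, (fderiv ℝ g q).ker = (fderiv ℝ f q).ker := by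
      filter_upwards [hker, hdim, hlow] with q h1 h2 h3
      refine Submodule.eq_of_le_of_finrank_le h1 ?_
      have := rn q
      have := rn' q
      have := rn p
      have := rn' p
      omega
    have hball : ∀ᶠ y in 𝓝 (0 : (fderiv ℝ f p).ker), DifferentiableAt ℝ (fun z => g (κ z)) y ∧
        fderiv ℝ (fun z => g (κ z)) y = 0 := by
      filter_upwards [hfκ.eventually_nhds, hκc.eventually (by simp), hκt (hf.eventually (by simp)),
        hκt (hg.eventually (by simp)), hκt heq] with y h1 h2 h3 h4 h5
      have h3' : ContDiffAt ℝ 1 f (κ y) := h3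
      have h4' : ContDiffAt ℝ 1 g (κ y) := h4
      have hky : HasFDerivAt κ (fderiv ℝ κ y) y := (h2.differentiableAt one_ne_zero).hasFDerivAt
      have hfy : HasFDerivAt (fun z => f (κ z)) ((fderiv ℝ f (κ y)).comp (fderiv ℝ κ y)) y :=
        (h3'.differentiableAt one_ne_zero).hasFDerivAt.comp y hky
      have hgy : HasFDerivAt (fun z => g (κ z)) ((fderiv ℝ g (κ y)).comp (fderiv ℝ κ y)) y :=
        (h4'.differentiableAt one_ne_zero).hasFDerivAt.comp y hky
      refine ⟨hgy.differentiableAt, ?_⟩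
      rw [hgy.fderiv]
      have hz := hfy.unique ((hasFDerivAt_const (f p) y).congr_of_eventuallyEq h1)
      ext w
      have hw : fderiv ℝ κ y w ∈ (fderiv ℝ f (κ y)).ker := by
        simpa using DFunLike.congr_fun hz w
      have h5' : (fderiv ℝ g (κ y)).ker = (fderiv ℝ f (κ y)).ker := h5
      rw [← h5'] at hw
      simpa using hw
    have hgκ : ∀ᶠ y in 𝓝 0, g (κ y) = g p := by
      obtain ⟨ε, hε, hb⟩ := Metric.eventually_nhds_iff_ball.1 hball
      filter_upwards [Metric.ball_mem_nhds 0 hε] with y hy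
      have := Metric.isOpen_ball.is_const_of_fderiv_eq_zero (f := fun z => g (κ z))
        (convex_ball (0 : (fderiv ℝ f p).ker) ε).isPreconnected
        (fun z hz => (hb z hz).1.differentiableWithinAt) (fun z hz => (hb z hz).2) hy
        (Metric.mem_ball_self hε)
      simpa [hκ0] using this
    have hρt : Filter.Tendsto ρ (𝓝 p) (𝓝 0) := by
      have := hρc.tendsto; rwa [hρ0] at this
    filter_upwards [hρt hgκ, hκρ] with q h1 h2 hfq
    have h1' : g (κ (ρ q)) = g p := h1
    rwa [h2 hfq] at h1'

end ConstantRank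

/-! ### Skew-symmetric endomorphisms and their dimension -/

section SkewMaps

open scoped RealInnerProductSpace

/-- The skew-symmetric endomorphisms of a real inner product space. -/
def skewMaps (V : Type*) [NormedAddCommGroup V] [InnerProductSpace ℝ V] :
    Submodule ℝ (V →ₗ[ℝ] V) where
  carrier := {S | ∀ x y, ⟪S x, y⟫ = -⟪x, S y⟫}
  add_mem' {S T} hS hT x y := by
    simp only [LinearMap.add_apply, inner_add_left, inner_add_right, hS x y, hT x y]; ring
  zero_mem' x y := by simp
  smul_mem' c S hS x y := by
    simp only [LinearMap.smul_apply, real_inner_smul_left, real_inner_smul_right, hS x y]; ring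

theorem inner_single_apply {d : ℕ} (S : EuclideanSpace ℝ (Fin d) →ₗ[ℝ] EuclideanSpace ℝ (Fin d))
    (i j : Fin d) : ⟪S (EuclideanSpace.single j 1), EuclideanSpace.single i 1⟫ =
      S (EuclideanSpace.single j 1) i := by
  simp [EuclideanSpace.inner_single_right]

/-- A skew-symmetric endomorphism is determined by the entries of its matrix above the diagonal,
which are arbitrary. -/
theorem finrank_skewMaps (d : ℕ) :
    Module.finrank ℝ (skewMaps (EuclideanSpace ℝ (Fin d))) =
      Fintype.card {ij : Fin d × Fin d // ij.1 < ij.2} := by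
  let Φ : skewMaps (EuclideanSpace ℝ (Fin d)) →ₗ[ℝ] ({ij : Fin d × Fin d // ij.1 < ij.2} → ℝ) :=
    { toFun := fun S ij => S.1 (EuclideanSpace.single ij.1.2 1) ij.1.1
      map_add' := fun S T => by ext; simp
      map_smul' := fun c S => by ext; simp }
  have hinj : Function.Injective Φ := by
    rw [← LinearMap.ker_eq_bot, LinearMap.ker_eq_bot']
    intro S hS
    have hanti (i j : Fin d) : S.1 (EuclideanSpace.single j 1) i =
        -S.1 (EuclideanSpace.single i 1) j := by
      rw [← inner_single_apply, S.2, real_inner_comm, inner_single_apply]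
    have hlt (i j : Fin d) (h : i < j) : S.1 (EuclideanSpace.single j 1) i = 0 :=
      congrFun hS ⟨(i, j), h⟩
    have h0 : S.1 = 0 := by
      refine (EuclideanSpace.basisFun (Fin d) ℝ).toBasis.ext fun j => ?_
      ext i
      simp only [OrthonormalBasis.coe_toBasis, EuclideanSpace.basisFun_apply,
        LinearMap.zero_apply, PiLp.zero_apply]
      rcases lt_trichotomy i j with h | rfl | h
      · exact hlt i j h
      · have := hanti i i
        linarith
      · rw [hanti, hlt j i h, neg_zero]
    exact Subtype.ext h0
  have hsurj : Function.Surjective Φ := by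
    intro c
    let M : Matrix (Fin d) (Fin d) ℝ := fun i j =>
      if h : i < j then c ⟨(i, j), h⟩ else if h : j < i then -c ⟨(j, i), h⟩ else 0
    have hM (i j : Fin d) : M i j = -M j i := by
      simp only [M]
      rcases lt_trichotomy i j with h | rfl | h
      · simp [h, h.not_gt]
      · simp
      · simp [h, h.not_gt]
    refine ⟨⟨Matrix.toEuclideanLin M, fun x y => ?_⟩, ?_⟩
    · simp only [PiLp.inner_apply, Matrix.toLpLin_apply, Matrix.mulVec, dotProduct,
        RCLike.inner_apply, conj_trivial, Finset.mul_sum, Finset.sum_mul]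
      rw [Finset.sum_comm, ← Finset.sum_neg_distrib]
      refine Finset.sum_congr rfl fun i _ => ?_
      rw [← Finset.sum_neg_distrib]
      refine Finset.sum_congr rfl fun j _ => ?_
      rw [hM j i]; ring
    · ext ⟨⟨i, j⟩, h⟩
      have h' : i < j := h
      have hij : M i j = c ⟨(i, j), h⟩ := by simp [M, h']
      rw [← hij]
      change Matrix.toEuclideanLin M (EuclideanSpace.single j 1) i = M i j
      simp
  rw [(LinearEquiv.ofBijective Φ ⟨hinj, hsurj⟩).finrank_eq, Module.finrank_fintype_fun_eq_card]

end SkewMaps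

/-! ### Infinitesimal motions and similarities -/

section Motions

open scoped RealInnerProductSpace

variable {n d : ℕ}

/-- The infinitesimal motions of `q`: the velocities that preserve all distances to first order. -/
def infinitesimalMotions (q : Config n d) : Submodule ℝ (Config n d) where
  carrier := {v | ∀ i j, ⟪q i - q j, v i - v j⟫ = 0}
  add_mem' {v w} hv hw i j := by
    have := hv i j
    have := hw i j
    simp only [inner_sub_right, Pi.add_apply, inner_add_right] at *
    linarith
  zero_mem' i j := by simp
  smul_mem' c v hv i j := by
    simp only [Pi.smul_apply, ← smul_sub, real_inner_smul_right, hv i j, mul_zero]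

theorem mem_infinitesimalMotions {q v : Config n d} :
    v ∈ infinitesimalMotions q ↔ ∀ i j, ⟪q i - q j, v i - v j⟫ = 0 := Iff.rfl

theorem span_sub_eq_top {q : Config n d} (hq : affineSpan ℝ (Set.range q) = ⊤) (i₀ : Fin n) :
    Submodule.span ℝ (Set.range fun i => q i - q i₀) = ⊤ := by
  have := vectorSpan_range_eq_span_range_vsub_right ℝ q i₀
  rw [← direction_affineSpan, hq, AffineSubspace.direction_top] at this
  simpa using this.symm

/-- The velocity field of a rotation `S` and a translation `t`, at the points of `q`. -/
def trivialMotion (q : Config n d) :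
    (skewMaps (EuclideanSpace ℝ (Fin d)) × EuclideanSpace ℝ (Fin d)) →ₗ[ℝ] Config n d where
  toFun x i := x.1.1 (q i) + x.2
  map_add' x y := by ext i; simp; ring
  map_smul' c x := by ext i; simp

theorem nonempty_of_affineSpan_eq_top {q : Config n d}
    (hq : affineSpan ℝ (Set.range q) = ⊤) : Nonempty (Fin n) := by
  by_contra h
  rw [not_nonempty_iff] at h
  rw [Set.range_eq_empty, AffineSubspace.span_empty] at hq
  exact AffineSubspace.bot_ne_top ℝ _ _ hq

theorem injective_trivialMotion {q : Config n d} (hq : affineSpan ℝ (Set.range q) = ⊤) :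
    Function.Injective (trivialMotion q) := by
  obtain ⟨i₀⟩ := nonempty_of_affineSpan_eq_top hq
  rw [← LinearMap.ker_eq_bot, LinearMap.ker_eq_bot']
  rintro ⟨S, t⟩ h
  have h' (i : Fin n) : S.1 (q i) + t = 0 := congrFun h i
  have hS : S.1 = 0 := by
    refine LinearMap.ext_on_range (span_sub_eq_top hq i₀) fun i => ?_
    rw [map_sub, eq_neg_of_add_eq_zero_left (h' i), eq_neg_of_add_eq_zero_left (h' i₀)]
    simp
  have ht : t = 0 := by simpa [hS] using h' i₀
  exact Prod.ext (Subtype.ext hS) ht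

/-- The complete graph on an affinely spanning configuration is infinitesimally rigid. -/
theorem range_trivialMotion {q : Config n d} (hq : affineSpan ℝ (Set.range q) = ⊤) :
    (trivialMotion q).range = infinitesimalMotions q := by
  obtain ⟨i₀⟩ := nonempty_of_affineSpan_eq_top hq
  apply le_antisymm
  · rintro _ ⟨⟨S, t⟩, rfl⟩ i j
    have h := S.2 (q i - q j) (q i - q j)
    rw [real_inner_comm] at h
    have : trivialMotion q (S, t) i - trivialMotion q (S, t) j = S.1 (q i - q j) := by
      simp [trivialMotion]
    rw [this]
    linarith
  · intro v hv
    rw [mem_infinitesimalMotions] at hv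
    -- The rotation sought is the map `S` with `S ∘ A = W`; it exists once `W` vanishes on the
    -- kernel of the surjection `A`.
    let A := Fintype.linearCombination ℝ fun i => q i - q i₀
    let W := Fintype.linearCombination ℝ fun i => v i - v i₀
    have hA : A.range = ⊤ := by
      rw [Fintype.range_linearCombination]; exact span_sub_eq_top hq i₀
    -- Polarization: in the relation for `(i, j)`, expanded around `i₀`, only the mixed terms
    -- survive.
    have hpair (i j : Fin n) :
        ⟪v i - v i₀, q j - q i₀⟫ + ⟪q i - q i₀, v j - v i₀⟫ = 0 := by
      have h1 := hv i i₀
      have h2 := hv j i₀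
      have h3 := hv i j
      have e1 : q i - q j = (q i - q i₀) - (q j - q i₀) := by abel
      have e2 : v i - v j = (v i - v i₀) - (v j - v i₀) := by abel
      rw [e1, e2, inner_sub_left, inner_sub_right (q i - q i₀) (v i - v i₀),
        inner_sub_right (q j - q i₀) (v i - v i₀), h1, h2,
        real_inner_comm (v i - v i₀)] at h3
      linarith
    have hWA (c c' : Fin n → ℝ) : ⟪W c, A c'⟫ = -⟪A c, W c'⟫ := by
      rw [← sub_eq_zero, sub_neg_eq_add]
      simp only [W, A, Fintype.linearCombination_apply, sum_inner, inner_sum,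
        real_inner_smul_left, real_inner_smul_right, ← Finset.sum_add_distrib]
      refine Finset.sum_eq_zero fun i _ => Finset.sum_eq_zero fun j _ => ?_
      linear_combination c j * c' i * hpair j i
    obtain ⟨σ, hσ⟩ := A.exists_rightInverse_of_surjective hA
    have hσ' (x) : A (σ x) = x := LinearMap.congr_fun hσ x
    -- By `hWA`, `W c` is orthogonal to the range of `A`, which is the whole space.
    have hW (c : Fin n → ℝ) (hc : A c = 0) : W c = 0 := by
      refine ext_inner_right ℝ fun x => ?_
      rw [← hσ' x, hWA, hc]; simp
    have hS : W ∘ₗ σ ∈ skewMaps (EuclideanSpace ℝ (Fin d)) := fun x y => by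
      have := hWA (σ x) (σ y)
      rwa [hσ', hσ'] at this
    have hSi (i : Fin n) : W (σ (q i - q i₀)) = v i - v i₀ := by
      have h1 : A (Pi.single i 1) = q i - q i₀ := by simp [A]
      have h2 : W (Pi.single i 1) = v i - v i₀ := by simp [W]
      rw [← h2, ← sub_eq_zero, ← map_sub]
      apply hW
      rw [map_sub, hσ', h1, sub_self]
    refine ⟨(⟨W ∘ₗ σ, hS⟩, v i₀ - W (σ (q i₀))), ?_⟩
    funext i
    have := hSi i
    rw [map_sub, map_sub] at this
    change W (σ (q i)) + (v i₀ - W (σ (q i₀))) = v i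
    rw [add_sub_left_comm, this]; abel

theorem finrank_infinitesimalMotions {q : Config n d} (hq : affineSpan ℝ (Set.range q) = ⊤) :
    Module.finrank ℝ (infinitesimalMotions q) =
      Fintype.card {ij : Fin d × Fin d // ij.1 < ij.2} + d := by
  rw [← range_trivialMotion hq, LinearMap.finrank_range_of_inj (injective_trivialMotion hq),
    Module.finrank_prod, finrank_skewMaps, finrank_euclideanSpace, Fintype.card_fin]

/-- The infinitesimal motions and dilations of `q`. -/
def infinitesimalSimilarities (q : Config n d) : Submodule ℝ (Config n d) :=
  infinitesimalMotions q ⊔ ℝ ∙ q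

theorem exists_ne_of_affineSpan_eq_top (hd : 0 < d) {q : Config n d}
    (hq : affineSpan ℝ (Set.range q) = ⊤) : ∃ i j, q i ≠ q j := by
  obtain ⟨i₀⟩ := nonempty_of_affineSpan_eq_top hq
  by_contra! h
  have h1 := span_sub_eq_top hq i₀
  have h2 : (fun i => q i - q i₀) = fun _ => 0 := funext fun i => by simp [h i i₀]
  have : Submodule.span ℝ (Set.range fun i => q i - q i₀) = ⊥ := by
    rw [Submodule.span_eq_bot, h2]; rintro _ ⟨i, rfl⟩; rfl
  rw [this] at h1
  have h3 := congrArg (fun W : Submodule ℝ (EuclideanSpace ℝ (Fin d)) => Module.finrank ℝ W) h1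
  simp only [finrank_bot, finrank_top, finrank_euclideanSpace, Fintype.card_fin] at h3
  omega

/-- The dilation field `q` changes some nonzero distance to first order, so it is not a motion and
contributes exactly one dimension. -/
theorem finrank_infinitesimalSimilarities (hd : 0 < d) {q : Config n d}
    (hq : affineSpan ℝ (Set.range q) = ⊤) :
    Module.finrank ℝ (infinitesimalSimilarities q) =
      Fintype.card {ij : Fin d × Fin d // ij.1 < ij.2} + d + 1 := by
  obtain ⟨i, j, hij⟩ := exists_ne_of_affineSpan_eq_top hd hq
  have hnot : q ∉ infinitesimalMotions q := fun h => by
    have := h i j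
    rw [inner_self_eq_zero, sub_eq_zero] at this
    exact hij this
  have hq0 : q ≠ 0 := fun h => hnot (h ▸ Submodule.zero_mem _)
  have hinf : infinitesimalMotions q ⊓ ℝ ∙ q = ⊥ := by
    rw [← disjoint_iff]
    exact Submodule.disjoint_span_singleton_of_notMem hnot
  have := Submodule.finrank_sup_add_finrank_inf_eq (infinitesimalMotions q) (ℝ ∙ q)
  rw [hinf, finrank_bot, finrank_span_singleton hq0, finrank_infinitesimalMotions hq] at this
  exact this

/-- Some `d + 1` of the points are affinely independent. This is an open condition, and `d + 1`
independent points span. -/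
theorem eventually_affineSpan_eq_top {p : Config n d} (hp : affineSpan ℝ (Set.range p) = ⊤) :
    ∀ᶠ q in 𝓝 p, affineSpan ℝ (Set.range q) = ⊤ := by
  obtain ⟨t, ht, hspan, hind⟩ :=
    exists_affineIndependent ℝ (EuclideanSpace ℝ (Fin d)) (Set.range p)
  have : Finite t := (Set.finite_range p).subset ht
  have := Fintype.ofFinite t
  choose s hs using fun x : t => ht x.2
  have hps : (fun x => p (s x)) = ((↑) : t → EuclideanSpace ℝ (Fin d)) := funext hs
  have hcard : Fintype.card t = Module.finrank ℝ (EuclideanSpace ℝ (Fin d)) + 1 := by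
    rw [← hind.affineSpan_eq_top_iff_card_eq_finrank_add_one, Subtype.range_coe, hspan, hp]
  have hopen := (isOpen_setOfPred_affineIndependent (𝕜 := ℝ) (E := EuclideanSpace ℝ (Fin d))
    (ι := t)).mem_nhds (x := fun x => p (s x)) (by rw [hps]; exact hind)
  have hc : ContinuousAt (fun (q : Config n d) (x : t) => q (s x)) p :=
    (continuous_pi fun x => continuous_apply (s x)).continuousAt
  filter_upwards [hc hopen] with q hq
  have hq' : AffineIndependent ℝ fun x : t => q (s x) := hq
  have h1 := hq'.affineSpan_eq_top_iff_card_eq_finrank_add_one.2 hcard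
  rw [eq_top_iff, ← h1]
  exact affineSpan_mono ℝ (by rintro _ ⟨x, rfl⟩; exact ⟨s x, rfl⟩)

end Motions

/-! ### Squared distances, shape, and the law of cosines -/

section SquaredDistances

open scoped RealInnerProductSpace

variable {n d : ℕ}

/-- All squared distances of a configuration. -/
def sqDist (q : Config n d) : Fin n × Fin n → ℝ := fun ij => ‖q ij.1 - q ij.2‖ ^ 2

/-- The squared distances of a configuration, normalized by their sum. -/
def shape (q : Config n d) : Fin n × Fin n → ℝ := (∑ ij, sqDist q ij)⁻¹ • sqDist q

theorem contDiff_sqDist : ContDiff ℝ 1 (sqDist : Config n d → Fin n × Fin n → ℝ) := by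
  refine contDiff_pi.2 fun ij => ContDiff.norm_sq ℝ ?_
  exact (contDiff_apply ℝ _ ij.1).sub (contDiff_apply ℝ _ ij.2)

theorem fderiv_sqDist_apply (q v : Config n d) (ij : Fin n × Fin n) :
    fderiv ℝ sqDist q v ij = 2 * ⟪q ij.1 - q ij.2, v ij.1 - v ij.2⟫ := by
  have h0 := hasFDerivAt_pi'.1 (contDiff_sqDist.differentiable one_ne_zero q).hasFDerivAt ij
  have h1 : HasFDerivAt (fun q : Config n d => q ij.1 - q ij.2)
      (ContinuousLinearMap.proj (R := ℝ) (φ := fun _ : Fin n => EuclideanSpace ℝ (Fin d)) ij.1 -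
        ContinuousLinearMap.proj ij.2) q :=
    (hasFDerivAt_apply ij.1 q).sub (hasFDerivAt_apply ij.2 q)
  have h2 := DFunLike.congr_fun (h0.unique h1.norm_sq) v
  simpa [inner_sub_left, inner_sub_right] using h2

theorem ker_fderiv_sqDist (q : Config n d) :
    (fderiv ℝ sqDist q).ker = infinitesimalMotions q := by
  ext v
  rw [mem_infinitesimalMotions, LinearMap.mem_ker, ContinuousLinearMap.coe_coe]
  constructor
  · intro h i j
    have := congrFun h (i, j)
    rw [fderiv_sqDist_apply] at this
    simpa using this
  · intro h
    funext ij
    rw [fderiv_sqDist_apply, h]; simp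

theorem sum_sqDist_pos {q : Config n d} (hq : ∃ i j, q i ≠ q j) : 0 < ∑ ij, sqDist q ij := by
  obtain ⟨i, j, hij⟩ := hq
  refine Finset.sum_pos' (fun _ _ => sq_nonneg _) ⟨(i, j), Finset.mem_univ _, ?_⟩
  have : 0 < ‖q i - q j‖ := norm_pos_iff.2 (sub_ne_zero.2 hij)
  simp only [sqDist]
  positivity

theorem contDiff_sum_sqDist : ContDiff ℝ 1 fun q : Config n d => ∑ ij, sqDist q ij :=
  ContDiff.sum fun ij _ => contDiff_pi.1 contDiff_sqDist ij

theorem contDiffAt_shape {q : Config n d} (hq : ∃ i j, q i ≠ q j) : ContDiffAt ℝ 1 shape q :=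
  (contDiff_sum_sqDist.contDiffAt.inv (sum_sqDist_pos hq).ne').smul contDiff_sqDist.contDiffAt

theorem fderiv_sqDist_self (q : Config n d) : fderiv ℝ sqDist q q = (2 : ℝ) • sqDist q := by
  funext ij
  rw [fderiv_sqDist_apply, real_inner_self_eq_norm_sq]; rfl

/-- By the quotient rule, `v` is in the kernel exactly when it changes the squared distances
proportionally to themselves. A dilation has the same effect, and subtracting it leaves a motion. -/
theorem ker_fderiv_shape {q : Config n d} (hq : ∃ i j, q i ≠ q j) :
    (fderiv ℝ shape q).ker = infinitesimalSimilarities q := by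
  have hs := sum_sqDist_pos hq
  set s := ∑ ij, sqDist q ij with hsdef
  have hD : HasFDerivAt (sqDist : Config n d → _) (fderiv ℝ sqDist q) q :=
    (contDiff_sqDist.differentiable one_ne_zero q).hasFDerivAt
  have hsum : HasFDerivAt (fun q : Config n d => ∑ ij, sqDist q ij)
      (∑ ij, (ContinuousLinearMap.proj (R := ℝ) (φ := fun _ : Fin n × Fin n => ℝ) ij).comp
        (fderiv ℝ sqDist q)) q :=
    HasFDerivAt.fun_sum fun ij _ => hasFDerivAt_pi'.1 hD ij
  have hinv : HasFDerivAt (fun q : Config n d => (∑ ij, sqDist q ij)⁻¹) _ q :=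
    (hasDerivAt_inv hs.ne').comp_hasFDerivAt q hsum
  have hshape : ∀ v, fderiv ℝ shape q v =
      s⁻¹ • (fderiv ℝ sqDist q v - (s⁻¹ * ∑ ij, fderiv ℝ sqDist q v ij) • sqDist q) := by
    intro v
    have : HasFDerivAt (shape : Config n d → _) _ q := hinv.smul hD
    rw [this.fderiv]
    ext ij
    simp [← hsdef]
    field_simp
    ring
  have hself : fderiv ℝ shape q q = 0 := by
    rw [hshape, fderiv_sqDist_self]
    simp only [Pi.smul_apply, smul_eq_mul, ← Finset.mul_sum]
    rw [← hsdef, mul_left_comm, inv_mul_cancel₀ hs.ne', mul_one, sub_self, smul_zero]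
  apply le_antisymm
  · intro v hv
    have hv' : fderiv ℝ shape q v = 0 := hv
    rw [hshape, smul_eq_zero_iff_right (inv_ne_zero hs.ne'), sub_eq_zero] at hv'
    set c := s⁻¹ * ∑ ij, fderiv ℝ sqDist q v ij
    -- The factor is `c / 2` because the field `q` changes the squared distances by `2 • sqDist q`.
    have hmem : v - (c / 2) • q ∈ infinitesimalMotions q := by
      rw [← ker_fderiv_sqDist, LinearMap.mem_ker, ContinuousLinearMap.coe_coe, map_sub, map_smul,
        hv', fderiv_sqDist_self, smul_smul, div_mul_cancel₀ _ two_ne_zero, sub_self]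
    have := Submodule.add_mem_sup hmem
      (Submodule.smul_mem (ℝ ∙ q) (c / 2) (Submodule.mem_span_singleton_self q))
    rwa [sub_add_cancel] at this
  · refine sup_le (fun v hv => ?_) ((Submodule.span_singleton_le_iff_mem _ _).2 hself)
    rw [← ker_fderiv_sqDist] at hv
    have hv' : fderiv ℝ sqDist q v = 0 := hv
    have : fderiv ℝ shape q v = 0 := by rw [hshape, hv']; simp
    exact this

theorem congruent_iff_sqDist_eq {p q : Config n d} : Congruent q p ↔ sqDist q = sqDist p := by
  rw [funext_iff, Prod.forall]
  refine forall₂_congr fun i j => ?_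
  simp only [sqDist]
  rw [sq_eq_sq₀ (norm_nonneg _) (norm_nonneg _)]

/-- Normalizing removes the scale; conversely `C` is recovered as the square root of the ratio of
the two sums. -/
theorem proportionallyCongruent_iff_shape_eq {p q : Config n d} (hp : ∃ i j, p i ≠ p j)
    (hq : ∃ i j, q i ≠ q j) : ProportionallyCongruent q p ↔ shape q = shape p := by
  have hsp := sum_sqDist_pos hp
  have hsq := sum_sqDist_pos hq
  constructor
  · rintro ⟨C, hC, h⟩
    have h1 : sqDist q = C ^ 2 • sqDist p := by
      funext ij
      simp only [sqDist, Pi.smul_apply, smul_eq_mul, h, mul_pow]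
    simp only [shape, h1, Pi.smul_apply, smul_eq_mul, ← Finset.mul_sum, smul_smul]
    congr 1
    field_simp
  · intro h
    have h1 : sqDist q = ((∑ ij, sqDist q ij) / ∑ ij, sqDist p ij) • sqDist p := by
      have := congrArg (fun y => (∑ ij, sqDist q ij) • y) h
      simp only [shape, smul_smul] at this
      rwa [mul_inv_cancel₀ hsq.ne', one_smul, ← div_eq_mul_inv] at this
    refine ⟨√((∑ ij, sqDist q ij) / ∑ ij, sqDist p ij), Real.sqrt_pos.2 (div_pos hsq hsp),
      fun i j => ?_⟩
    rw [← sq_eq_sq₀ (norm_nonneg _) (by positivity), mul_pow, Real.sq_sqrt (by positivity)]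
    exact congrFun h1 (i, j)

/-- The cosine of an angle of a triangle in terms of its squared side lengths. -/
def cosOfSqDist (t : Fin n × Fin n × Fin n) (y : Fin n × Fin n → ℝ) : ℝ :=
  (y (t.1, t.2.1) + y (t.1, t.2.2) - y (t.2.1, t.2.2)) /
    (2 * (√(y (t.1, t.2.1)) * √(y (t.1, t.2.2))))

theorem cosAngle_eq_cosOfSqDist (t : Fin n × Fin n × Fin n) (q : Config n d) :
    cosAngle t q = cosOfSqDist t (sqDist q) := by
  simp only [cosAngle, cosOfSqDist, sqDist, EuclideanGeometry.angle,
    InnerProductGeometry.cos_angle, Real.sqrt_sq (norm_nonneg _), vsub_eq_sub]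
  rw [real_inner_eq_norm_mul_self_add_norm_mul_self_sub_norm_sub_mul_self_div_two,
    sub_sub_sub_cancel_right, norm_sub_rev (q t.1) (q t.2.1), norm_sub_rev (q t.1) (q t.2.2),
    div_div]
  simp only [sq]

theorem cosOfSqDist_smul (t : Fin n × Fin n × Fin n) {c : ℝ} (hc : 0 < c)
    (y : Fin n × Fin n → ℝ) : cosOfSqDist t (c • y) = cosOfSqDist t y := by
  simp only [cosOfSqDist, Pi.smul_apply, smul_eq_mul, Real.sqrt_mul hc.le, ← mul_add, ← mul_sub]
  have h : 2 * (√c * √(y (t.1, t.2.1)) * (√c * √(y (t.1, t.2.2)))) =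
      c * (2 * (√(y (t.1, t.2.1)) * √(y (t.1, t.2.2)))) := by
    linear_combination 2 * √(y (t.1, t.2.1)) * √(y (t.1, t.2.2)) * Real.mul_self_sqrt hc.le
  rw [h, mul_div_mul_left _ _ hc.ne']

theorem cosAngle_eq_cosOfSqDist_shape (t : Fin n × Fin n × Fin n) {q : Config n d}
    (hq : ∃ i j, q i ≠ q j) : cosAngle t q = cosOfSqDist t (shape q) := by
  rw [shape, cosOfSqDist_smul t (inv_pos.2 (sum_sqDist_pos hq)), cosAngle_eq_cosOfSqDist]

/-- The conditions on `y` and on `√y` play different roles: the first makes the square root smooth,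
the second keeps the denominator nonzero, as `√` is zero on negative numbers. -/
theorem contDiffAt_cosOfSqDist (t : Fin n × Fin n × Fin n) {y : Fin n × Fin n → ℝ}
    (h1 : y (t.1, t.2.1) ≠ 0) (h2 : y (t.1, t.2.2) ≠ 0)
    (h3 : √(y (t.1, t.2.1)) ≠ 0) (h4 : √(y (t.1, t.2.2)) ≠ 0) :
    ContDiffAt ℝ 1 (cosOfSqDist t) y := by
  have hc (ij : Fin n × Fin n) : ContDiffAt ℝ 1 (fun y : Fin n × Fin n → ℝ => y ij) y :=
    (contDiff_apply ℝ ℝ ij).contDiffAt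
  exact (((hc _).add (hc _)).sub (hc _)).div
    (contDiffAt_const.mul (((hc _).sqrt h1).mul ((hc _).sqrt h2)))
    (mul_ne_zero two_ne_zero (mul_ne_zero h3 h4))

theorem sqDist_pos {q : Config n d} {i j : Fin n} (h : q i ≠ q j) : 0 < sqDist q (i, j) := by
  have : 0 < ‖q i - q j‖ := norm_pos_iff.2 (sub_ne_zero.2 h)
  simp only [sqDist]
  positivity

theorem contDiffAt_cosOfSqDist_sqDist {t : Fin n × Fin n × Fin n} {q : Config n d}
    (h1 : q t.1 ≠ q t.2.1) (h2 : q t.1 ≠ q t.2.2) :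
    ContDiffAt ℝ 1 (cosOfSqDist t) (sqDist q) :=
  contDiffAt_cosOfSqDist t (sqDist_pos h1).ne' (sqDist_pos h2).ne'
    (Real.sqrt_pos.2 (sqDist_pos h1)).ne' (Real.sqrt_pos.2 (sqDist_pos h2)).ne'

theorem contDiffAt_cosOfSqDist_shape {t : Fin n × Fin n × Fin n} {q : Config n d}
    (h1 : q t.1 ≠ q t.2.1) (h2 : q t.1 ≠ q t.2.2) :
    ContDiffAt ℝ 1 (cosOfSqDist t) (shape q) := by
  have hs := inv_pos.2 (sum_sqDist_pos ⟨_, _, h1⟩)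
  have e1 := mul_pos hs (sqDist_pos h1)
  have e2 := mul_pos hs (sqDist_pos h2)
  exact contDiffAt_cosOfSqDist t e1.ne' e2.ne' (Real.sqrt_pos.2 e1).ne' (Real.sqrt_pos.2 e2).ne'

end SquaredDistances

/-! ### The weak rigidity function and the rank criteria -/

section WeakRigidityFunction

variable {n d : ℕ}

/-- Chain rule in each coordinate. The factorization is required only near `q`, because angles
factor through `shape` only where the points do not all coincide. -/
theorem ker_fderiv_le_of_eventuallyEq_comp {E F : Type*} [NormedAddCommGroup E] [NormedSpace ℝ E]
    [NormedAddCommGroup F] [NormedSpace ℝ F] {ι : Type*} [Fintype ι] {f : E → ι → ℝ} {g : E → F}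
    {h : ι → F → ℝ} {q : E} (hg : DifferentiableAt ℝ g q)
    (hh : ∀ a, DifferentiableAt ℝ (h a) (g q))
    (hf : ∀ a, (fun x => f x a) =ᶠ[𝓝 q] fun x => h a (g x)) :
    (fderiv ℝ g q).ker ≤ (fderiv ℝ f q).ker := by
  intro v hv
  have hv' : fderiv ℝ g q v = 0 := hv
  have hc (a : ι) : HasFDerivAt (fun x => f x a) ((fderiv ℝ (h a) (g q)).comp (fderiv ℝ g q)) q :=
    ((hh a).hasFDerivAt.comp q hg.hasFDerivAt).congr_of_eventuallyEq (hf a)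
  have : fderiv ℝ f q v = 0 := by
    rw [(hasFDerivAt_pi.2 hc).fderiv]
    funext a
    simp [hv']
  exact this

theorem isOpen_domain (A : Finset (Fin n × Fin n × Fin n)) :
    IsOpen (domain A : Set (Config n d)) := by
  have : (domain A : Set (Config n d)) =
      ⋂ t ∈ A, {p | p t.1 ≠ p t.2.1} ∩ {p | p t.1 ≠ p t.2.2} := by
    ext p; simp [domain]
  rw [this]
  exact isOpen_biInter_finset fun t _ =>
    (isOpen_ne_fun (continuous_apply t.1) (continuous_apply t.2.1)).inter
      (isOpen_ne_fun (continuous_apply t.1) (continuous_apply t.2.2))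

theorem exists_sqLength_eq_sqDist (e : Sym2 (Fin n)) :
    ∃ ij, ∀ q : Config n d, sqLength e q = sqDist q ij :=
  e.ind fun i j => ⟨(i, j), fun _ => rfl⟩

theorem exists_weakRigidityFunction_eq_comp_sqDist (G : SimpleGraph (Fin n))
    (A : Finset (Fin n × Fin n × Fin n)) (a : G.edgeSet ⊕ A) :
    ∃ h : (Fin n × Fin n → ℝ) → ℝ,
      (∀ q : Config n d, weakRigidityFunction G A q a = h (sqDist q)) ∧
      ∀ q ∈ (domain A : Set (Config n d)), ContDiffAt ℝ 1 h (sqDist q) := by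
  rcases a with e | t
  · obtain ⟨ij, hij⟩ := exists_sqLength_eq_sqDist (d := d) e.1
    exact ⟨fun y => y ij, hij, fun q _ => (contDiff_apply ℝ ℝ ij).contDiffAt⟩
  · exact ⟨cosOfSqDist t.1, cosAngle_eq_cosOfSqDist t.1, fun q hq =>
      contDiffAt_cosOfSqDist_sqDist (hq t.1 t.2).1 (hq t.1 t.2).2⟩

variable {G : SimpleGraph (Fin n)} {A : Finset (Fin n × Fin n × Fin n)} {p q : Config n d}

theorem contDiffAt_weakRigidityFunction [Fintype G.edgeSet] (hq : q ∈ domain A) :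
    ContDiffAt ℝ 1 (weakRigidityFunction G A : Config n d → G.edgeSet ⊕ A → ℝ) q := by
  refine contDiffAt_pi.2 fun a => ?_
  obtain ⟨h, h1, h2⟩ := exists_weakRigidityFunction_eq_comp_sqDist (d := d) G A a
  rw [funext h1]
  exact (h2 q hq).comp q contDiff_sqDist.contDiffAt

/-- The rank of the weak rigidity matrix is that of the derivative of the weak rigidity function. -/
theorem rank_weakRigidityMatrix [Fintype G.edgeSet] (hq : q ∈ domain A) :
    (weakRigidityMatrix G A q).rank = Module.finrank ℝ
      (fderiv ℝ (weakRigidityFunction G A : Config n d → G.edgeSet ⊕ A → ℝ) q).range := by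
  have hF := (contDiffAt_weakRigidityFunction (G := G) hq).differentiableAt one_ne_zero
  set D := fderiv ℝ (weakRigidityFunction G A : Config n d → G.edgeSet ⊕ A → ℝ) q with hD
  -- Regrouping coordinates into points identifies the matrix with the derivative; being an
  -- isomorphism, `e` does not affect the range.
  let e : (Fin n × Fin d → ℝ) ≃ₗ[ℝ] Config n d :=
    (LinearEquiv.curry ℝ ℝ (Fin n) (Fin d)).trans
      (LinearEquiv.piCongrRight fun _ => (WithLp.linearEquiv 2 ℝ (Fin d → ℝ)).symm)
  have hM : (weakRigidityMatrix G A q).mulVecLin = (D : Config n d →ₗ[ℝ] _) ∘ₗ e.toLinearMap := by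
    refine LinearMap.pi_ext' fun c => LinearMap.ext_ring ?_
    funext a
    have he : e (Pi.single c 1) = Pi.single c.1 (EuclideanSpace.single c.2 1) := by
      funext i
      ext l
      by_cases hi : i = c.1
      · subst hi
        by_cases hl : l = c.2
        · subst hl; simp [e]
        · simp [e, hl]
      · simp [e, hi]
    simp only [LinearMap.comp_apply, LinearMap.coe_single, Matrix.mulVecLin_apply,
      Matrix.mulVec_single_one, LinearEquiv.coe_coe, he, ContinuousLinearMap.coe_coe]
    simp only [weakRigidityMatrix, Matrix.col_apply, Matrix.of_apply]
    rw [(hasFDerivAt_pi'.1 hF.hasFDerivAt a).fderiv]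
    rfl
  rw [Matrix.rank, hM, LinearMap.range_comp, LinearEquiv.range, ← LinearMap.range_eq_map]

theorem stronglyEquivalent_iff :
    StronglyEquivalent G A q p ↔ weakRigidityFunction G A q = weakRigidityFunction G A p := by
  constructor
  · rintro ⟨h1, h2⟩
    funext a
    rcases a with ⟨e, he⟩ | t
    · induction e with
      | _ i j => exact congrArg (· ^ 2) (h1 i j he)
    · exact h2 t.1 t.2
  · intro h
    refine ⟨fun i j hij => ?_, fun t ht => congrFun h (Sum.inr ⟨t, ht⟩)⟩
    have : ‖q i - q j‖ ^ 2 = ‖p i - p j‖ ^ 2 :=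
      congrFun h (Sum.inl ⟨s(i, j), hij⟩)
    rwa [sq_eq_sq₀ (norm_nonneg _) (norm_nonneg _)] at this

theorem angleEquivalent_iff (hG : G.edgeSet = ∅) :
    AngleEquivalent A q p ↔ weakRigidityFunction G A q = weakRigidityFunction G A p := by
  rw [← stronglyEquivalent_iff]
  refine ⟨fun h => ⟨fun i j hij => ?_, h⟩, fun h => h.2⟩
  have : s(i, j) ∈ G.edgeSet := hij
  simp [hG] at this

theorem isGWR_iff_of_edgeSet_ne_empty (hp : p ∈ domain A) (hG : G.edgeSet ≠ ∅) :
    IsGWR G A p ↔ ∀ᶠ q in 𝓝 p,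
      weakRigidityFunction G A q = weakRigidityFunction G A p → sqDist q = sqDist p := by
  simp only [IsGWR, hG, false_and, or_false, stronglyEquivalent_iff, congruent_iff_sqDist_eq]
  rw [← Filter.eventually_iff_exists_mem]
  refine Filter.eventually_congr ?_
  filter_upwards [(isOpen_domain A).mem_nhds hp] with q hq
  simp [hq]

/-- Congruence is proportional congruence with `C = 1`, so the first alternative of `IsGWR` is
absorbed by the second. Openness of `domain A` removes the membership condition. -/
theorem isGWR_iff_of_edgeSet_eq_empty (hp : p ∈ domain A) (hp' : ∀ᶠ q in 𝓝 p, ∃ i j, q i ≠ q j)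
    (hG : G.edgeSet = ∅) :
    IsGWR G A p ↔ ∀ᶠ q in 𝓝 p,
      weakRigidityFunction G A q = weakRigidityFunction G A p → shape q = shape p := by
  simp only [IsGWR, hG, true_and, stronglyEquivalent_iff, angleEquivalent_iff hG]
  rw [← Filter.eventually_iff_exists_mem, ← Filter.eventually_iff_exists_mem]
  have h1 : (∀ᶠ q in 𝓝 p, q ∈ domain A → weakRigidityFunction G A q = weakRigidityFunction G A p →
      Congruent q p) → ∀ᶠ q in 𝓝 p, q ∈ domain A →
      weakRigidityFunction G A q = weakRigidityFunction G A p → ProportionallyCongruent q p :=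
    fun h => h.mono fun q hq h2 h3 => ⟨1, one_pos, fun i j => by rw [one_mul]; exact hq h2 h3 i j⟩
  rw [or_iff_right_of_imp h1]
  refine Filter.eventually_congr ?_
  filter_upwards [(isOpen_domain A).mem_nhds hp, hp'] with q hq hq'
  simp [hq, proportionallyCongruent_iff_shape_eq hp'.self_of_nhds hq']

theorem IsRegularPoint.eventually_finrank_range_le [Fintype G.edgeSet]
    (hreg : IsRegularPoint G A p) :
    ∀ᶠ q in 𝓝 p, Module.finrank ℝ
        (fderiv ℝ (weakRigidityFunction G A : Config n d → G.edgeSet ⊕ A → ℝ) q).range ≤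
      Module.finrank ℝ
        (fderiv ℝ (weakRigidityFunction G A : Config n d → G.edgeSet ⊕ A → ℝ) p).range := by
  filter_upwards [(isOpen_domain A).mem_nhds hreg.1] with q hq
  rw [← rank_weakRigidityMatrix hq, ← rank_weakRigidityMatrix hreg.1]
  exact hreg.2 hq

/-- The fibre criterion with `g = sqDist`, followed by rank-nullity. The additive form avoids
truncated subtraction. -/
theorem isGWR_iff_rank_eq_of_edgeSet_ne_empty (hreg : IsRegularPoint G A p)
    (hspan : affineSpan ℝ (Set.range p) = ⊤) (hG : G.edgeSet ≠ ∅) :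
    IsGWR G A p ↔ (weakRigidityMatrix G A p).rank +
      (Fintype.card {ij : Fin d × Fin d // ij.1 < ij.2} + d) = n * d := by
  have := Fintype.ofFinite G.edgeSet
  rw [isGWR_iff_of_edgeSet_ne_empty hreg.1 hG, rank_weakRigidityMatrix hreg.1,
    eventually_fiber_subset_iff (contDiffAt_weakRigidityFunction hreg.1)
      contDiff_sqDist.contDiffAt hreg.eventually_finrank_range_le]
  · have := LinearMap.finrank_range_add_finrank_ker (fderiv ℝ sqDist p : Config n d →ₗ[ℝ] (Fin n × Fin n → ℝ))
    rw [ker_fderiv_sqDist, finrank_infinitesimalMotions hspan] at this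
    simp only [Module.finrank_pi_fintype, finrank_euclideanSpace, Fintype.card_fin,
      Finset.sum_const, Finset.card_univ, smul_eq_mul] at this
    omega
  · filter_upwards [(isOpen_domain A).mem_nhds hreg.1] with q hq
    choose h h1 h2 using exists_weakRigidityFunction_eq_comp_sqDist (d := d) G A
    exact ker_fderiv_le_of_eventuallyEq_comp (contDiff_sqDist.differentiable one_ne_zero q)
      (fun a => (h2 a q hq).differentiableAt one_ne_zero) fun a => .of_forall (h1 a)
  · filter_upwards [eventually_affineSpan_eq_top hspan] with q hq
    rw [ker_fderiv_sqDist, ker_fderiv_sqDist, finrank_infinitesimalMotions hspan,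
      finrank_infinitesimalMotions hq]

theorem isGWR_iff_rank_eq_of_edgeSet_eq_empty (hd : 0 < d) (hreg : IsRegularPoint G A p)
    (hspan : affineSpan ℝ (Set.range p) = ⊤) (hG : G.edgeSet = ∅) :
    IsGWR G A p ↔ (weakRigidityMatrix G A p).rank +
      (Fintype.card {ij : Fin d × Fin d // ij.1 < ij.2} + d + 1) = n * d := by
  have := Fintype.ofFinite G.edgeSet
  have hne : ∀ᶠ q in 𝓝 p, ∃ i j, q i ≠ q j :=
    (eventually_affineSpan_eq_top hspan).mono fun q hq => exists_ne_of_affineSpan_eq_top hd hq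
  have hpne := hne.self_of_nhds
  rw [isGWR_iff_of_edgeSet_eq_empty hreg.1 hne hG, rank_weakRigidityMatrix hreg.1,
    eventually_fiber_subset_iff (contDiffAt_weakRigidityFunction hreg.1)
      (contDiffAt_shape hpne) hreg.eventually_finrank_range_le]
  · have := LinearMap.finrank_range_add_finrank_ker (fderiv ℝ shape p : Config n d →ₗ[ℝ] (Fin n × Fin n → ℝ))
    rw [ker_fderiv_shape hpne, finrank_infinitesimalSimilarities hd hspan] at this
    simp only [Module.finrank_pi_fintype, finrank_euclideanSpace, Fintype.card_fin,
      Finset.sum_const, Finset.card_univ, smul_eq_mul] at this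
    omega
  · filter_upwards [(isOpen_domain A).mem_nhds hreg.1, hne.eventually_nhds] with q hq hq'
    have hE : IsEmpty G.edgeSet := Set.isEmpty_coe_sort.2 hG
    refine ker_fderiv_le_of_eventuallyEq_comp
      (h := Sum.elim (fun _ _ => 0) fun t : A => cosOfSqDist t.1)
      ((contDiffAt_shape hq'.self_of_nhds).differentiableAt one_ne_zero) ?_ ?_
    · rintro (e | t)
      · exact isEmptyElim e
      · exact (contDiffAt_cosOfSqDist_shape (hq t.1 t.2).1 (hq t.1 t.2).2).differentiableAt
          one_ne_zero
    · rintro (e | t)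
      · exact isEmptyElim e
      · exact hq'.mono fun x hx => cosAngle_eq_cosOfSqDist_shape t.1 hx
  · filter_upwards [eventually_affineSpan_eq_top hspan, hne] with q hq hq'
    rw [ker_fderiv_shape hpne, ker_fderiv_shape hq', finrank_infinitesimalSimilarities hd hspan,
      finrank_infinitesimalSimilarities hd hq]

end WeakRigidityFunction

end WeakRigidity

end

theorem mainTheorem3 {n d : ℕ} (hd : d = 2 ∨ d = 3) (G : SimpleGraph (Fin n))
    (A : Finset (Fin n × Fin n × Fin n)) (p : Fin n → EuclideanSpace ℝ (Fin d))
    (hreg : WeakRigidity.IsRegularPoint G A p)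
    (hspan : affineSpan ℝ (Set.range p) = ⊤) :
    (G.edgeSet ≠ ∅ →
      (WeakRigidity.IsGWR G A p ↔
        ((WeakRigidity.weakRigidityMatrix G A p).rank : ℤ) =
          (d : ℤ) * n - (d : ℤ) * (d + 1) / 2)) ∧
    (G.edgeSet = ∅ →
      (WeakRigidity.IsGWR G A p ↔
        ((WeakRigidity.weakRigidityMatrix G A p).rank : ℤ) =
          (d : ℤ) * n - ((d : ℤ) ^ 2 + d + 2) / 2)) := by
  -- These are `d(d-1)/2` for `d = 2, 3`. Adding `d` gives `3` and `6`, that is `d(d+1)/2`; the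
  -- dilation raises them to `4` and `7`, that is `(d²+d+2)/2`.
  have h2 : Fintype.card {ij : Fin 2 × Fin 2 // ij.1 < ij.2} = 1 := by decide
  have h3 : Fintype.card {ij : Fin 3 × Fin 3 // ij.1 < ij.2} = 3 := by decide
  refine ⟨fun hG => ?_, fun hG => ?_⟩
  · rw [WeakRigidity.isGWR_iff_rank_eq_of_edgeSet_ne_empty hreg hspan hG]
    rcases hd with rfl | rfl
    · rw [h2]; push_cast; omega
    · rw [h3]; push_cast; omega
  · rw [WeakRigidity.isGWR_iff_rank_eq_of_edgeSet_eq_empty (by omega) hreg hspan hG]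
    rcases hd with rfl | rfl
    · rw [h2]; push_cast; omega
    · rw [h3]; push_cast; omega
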